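/- Let $\mathcal{A} \subset \mathbb{R}^n$ be a finite set (the atoms), $\mathcal{M} = \operatorname{conv}(\mathcal{A})$, and let $f : \mathbb{R}^n \to \mathbb{R}$ be convex on $\mathcal{M}$. Definitions. For $B \subseteq \mathcal{A}$ and a point $y$, an active set for $y$ over $B$ is a finite set $S \subseteq B$ such that $y = \sum_{v \in S} \alpha_v v$ with $\sum_{v\in S} \alpha_v = 1$ and $\alpha_v > 0$ for all $v \in S$; let $\mathcal{S}_y(B)$ be the set of these. For $y \in \operatorname{conv}(B)$ and $q \neq 0$ put $$\mathrm{PdirW}(B, q, y) = \min_{S \in \mathcal{S}_y(B)} \ \max_{s \in B,\, v \in S} \Big\langle \frac{q}{\|q\|}, s - v \Big\rangle ,$$ and define the pyramidal width $$\mathrm{PWidth}(\mathcal{A}) = \min_{K,\, y,\, q} \mathrm{PdirW}(K \cap \mathcal{A}, q, y),$$ the minimum being over all faces $K$ of $\mathcal{M}$ (including $\mathcal{M}$ itself), all $y \in K$ and all non-zero $q$ in the cone generated by $K - y$. Theorem. Let $x \in \mathcal{M}$ be a suboptimal point (not a minimizer of $f$ over $\mathcal{M}$), let $S$ be an active set for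 $x$ over $\mathcal{A}$, and let $x^*$ be a minimizer of $f$ over $\mathcal{M}$. Suppose $f$ is differentiable at $x$ relative to $\mathcal{M}$ with gradient $\nabla f(x)$ (if $\mathcal{M}$ is not full-dimensional, any vector representing the derivative of $f$ at $x$ within $\mathcal{M}$). Put $r = -\nabla f(x)$ and $\hat e = (x^* - x)/\|x^* - x\|$. Let $d = s - v$ be a pairwise Frank-Wolfe direction, i.e. $s \in \operatorname{argmax}_{a \in \mathcal{A}} \langle r, a\rangle$ and $v \in \operatorname{argmin}_{w \in S} \langle r, w \rangle$. Then $\langle r, \hat e\rangle > 0$ and $$\frac{\langle r, d\rangle}{\langle r, \hat e\rangle} \ \geq\ \mathrm{PWidth}(\mathcal{A}).$$ -/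

import Mathlib

open scoped InnerProductSpace

namespace PyramidalWidth

variable {E : Type*} [NormedAddCommGroup E] [InnerProductSpace ℝ E]

/-- `S` is an active set for `x` over the atoms `A`: a finite set of atoms such that `x` is a
proper convex combination (all coefficients non-zero) of all the elements of `S`. -/
def IsActiveSet (A : Set E) (x : E) (S : Finset E) : Prop :=
  (S : Set E) ⊆ A ∧
    ∃ α : E → ℝ, (∀ v ∈ S, 0 < α v) ∧ ∑ v ∈ S, α v = 1 ∧ ∑ v ∈ S, α v • v = x

/-- `d = s - v` is a pairwise Frank-Wolfe direction over the atoms `A` and the active set `S` with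
negative gradient `r`: `s` is an atom maximizing `⟪r, ·⟫` over `A` (an answer of the linear
minimization oracle at the gradient `-r`), and `v` is an away atom, minimizing `⟪r, ·⟫`
over `S`. -/
def IsPairwiseFWDirection (A : Set E) (S : Finset E) (r d : E) : Prop :=
  ∃ s ∈ A, ∃ v ∈ S, (∀ a ∈ A, ⟪r, a⟫_ℝ ≤ ⟪r, s⟫_ℝ) ∧ (∀ w ∈ S, ⟪r, v⟫_ℝ ≤ ⟪r, w⟫_ℝ) ∧ d = s - v

/-- `max` over `s ∈ A` and `v ∈ S` of `⟪r / ‖r‖, s - v⟫`: the directional width of the pyramid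
with base `S` whose summit is the Frank-Wolfe atom of `A` for the direction `r`. The supremum is
a maximum when `A` and `S` are finite and non-empty. -/
noncomputable def pyramidWidth (A : Set E) (S : Finset E) (r : E) : ℝ :=
  sSup {t : ℝ | ∃ s ∈ A, ∃ v ∈ S, t = ⟪‖r‖⁻¹ • r, s - v⟫_ℝ}

/-- The pyramidal directional width `PdirW(A, r, x)`: the minimum over all active sets `S` for `x`
of the directional width of the corresponding pyramid. -/
noncomputable def pyramidalDirWidth (A : Set E) (r x : E) : ℝ :=
  sInf {t : ℝ | ∃ S : Finset E, IsActiveSet A x S ∧ t = pyramidWidth A S r}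

/-- The direction `r` is feasible for the convex set `K` from `x`: it lies in the conic hull of
`K - x`. -/
def IsFeasibleDirection (K : Set E) (x r : E) : Prop :=
  r ∈ PointedCone.hull ℝ ((fun y => y - x) '' K)

/-- The pyramidal width `PWidth(A)`: the minimum of `PdirW(K ∩ A, r, x)` over the faces `K` of
`conv A` (including `conv A` itself), the points `x ∈ K` and the non-zero directions `r` that are
feasible for `K` from `x`. The faces of a polytope are its exposed faces. -/
noncomputable def pyramidalWidth (A : Set E) : ℝ :=
  sInf {t : ℝ | ∃ (K : Set E) (x r : E), IsExposed ℝ (convexHull ℝ A) K ∧ x ∈ K ∧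
    IsFeasibleDirection K x r ∧ r ≠ 0 ∧ t = pyramidalDirWidth (K ∩ A) r x}

end PyramidalWidth

namespace PyramidalWidth

open Set Filter Topology

section Preliminaries

variable {E : Type*} [NormedAddCommGroup E] [InnerProductSpace ℝ E]

/-! Moreau decomposition at `x`: let `q` be the projection of `r` onto the cone of feasible
directions. Then `r - q` is maximized over the polytope at `x` and exposes a face `K` that contains
`x` and every atom of `S`, and `q` is feasible for `K` (`exists_feasible_direction`). On `K` the
functionals of `r` and `q` differ by a constant, so the pyramid over `K ∩ A` in direction `q` has
width at most `⟪r, d⟫ / ‖q‖`. Finally `⟪r, ehat⟫ ≤ ⟪q, ehat⟫ ≤ ‖q‖`, and convexity of `f` makes `⟪r,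
ehat⟫` positive. -/

/-- A linear functional bounded on the points `z i` by its value at a convex combination of them
with positive weights is constant on these points. -/
theorem inner_eq_of_forall_inner_le {ι : Type*} {s : Finset ι} {w : ι → ℝ} {z : ι → E} {g y : E}
    (hw : ∀ i ∈ s, 0 < w i) (hw1 : ∑ i ∈ s, w i = 1) (hy : ∑ i ∈ s, w i • z i = y)
    (hle : ∀ i ∈ s, ⟪g, z i⟫_ℝ ≤ ⟪g, y⟫_ℝ) : ∀ i ∈ s, ⟪g, z i⟫_ℝ = ⟪g, y⟫_ℝ := by
  have hsum : ∑ i ∈ s, w i * (⟪g, y⟫_ℝ - ⟪g, z i⟫_ℝ) = 0 := by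
    have h : ⟪g, y⟫_ℝ = ∑ i ∈ s, w i * ⟪g, z i⟫_ℝ := by
      rw [← hy, inner_sum]
      simp_rw [real_inner_smul_right]
    simp_rw [mul_sub]
    rw [Finset.sum_sub_distrib, ← Finset.sum_mul, hw1, one_mul, ← h, sub_self]
  intro i hi
  have h0 := (Finset.sum_eq_zero_iff_of_nonneg fun j hj =>
    mul_nonneg (hw j hj).le (sub_nonneg.2 (hle j hj))).1 hsum i hi
  rcases mul_eq_zero.1 h0 with h | h
  · exact absurd h (hw i hi).ne'
  · linarith

theorem inner_eq_of_mem_convexHull {F : Set E} {g y : E} {c : ℝ} (hF : ∀ a ∈ F, ⟪g, a⟫_ℝ = c)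
    (hy : y ∈ convexHull ℝ F) : ⟪g, y⟫_ℝ = c :=
  convexHull_min (t := {z | ⟪g, z⟫_ℝ = c}) hF
    (convex_hyperplane (f := fun z => ⟪g, z⟫_ℝ) (innerₛₗ ℝ g).isLinear c) hy

theorem mem_convexHull_setOf_inner_eq {A : Set E} {g y : E} (hy : y ∈ convexHull ℝ A)
    (hle : ∀ a ∈ A, ⟪g, a⟫_ℝ ≤ ⟪g, y⟫_ℝ) :
    y ∈ convexHull ℝ {a ∈ A | ⟪g, a⟫_ℝ = ⟪g, y⟫_ℝ} := by
  obtain ⟨ι, _, z, w, hz, -, hw, hw1, hsum⟩ := eq_pos_convex_span_of_mem_convexHull hy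
  have hzA : ∀ i, z i ∈ A := fun i => hz ⟨i, rfl⟩
  have heq := inner_eq_of_forall_inner_le (s := Finset.univ) (fun i _ => hw i) hw1 hsum
    fun i _ => hle _ (hzA i)
  rw [← hsum]
  refine (convex_convexHull ℝ _).sum_mem (fun i _ => (hw i).le) hw1 fun i hi =>
    subset_convexHull ℝ _ ⟨hzA i, ?_⟩
  rw [hsum]
  exact heq i hi

/-- Points near `x` lie in the convex hulls of only those sets of atoms whose convex hulls
contain `x`. -/
theorem eventually_mem_convexHull_imp {A : Set E} (hA : A.Finite) (x : E) :
    ∀ᶠ p in 𝓝 x, ∀ F ⊆ A, p ∈ convexHull ℝ F → x ∈ convexHull ℝ F := by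
  have h : ∀ᶠ p in 𝓝 x, ∀ F ∈ 𝒫 A, p ∈ convexHull ℝ F → x ∈ convexHull ℝ F := by
    refine (eventually_all_finite hA.finite_subsets).2 ?_
    intro F hF
    by_cases hx : x ∈ convexHull ℝ F
    · exact Eventually.of_forall fun _ _ => hx
    · have hcl : IsClosed (convexHull ℝ F) := ((hA.subset hF).isCompact_convexHull (𝕜 := ℝ)).isClosed
      filter_upwards [hcl.isOpen_compl.mem_nhds hx] with p hp hp'
      exact absurd hp' hp
  exact h

/-- The nearest point `p` to `u`; testing its variational inequality at `z = x` and applying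
Cauchy-Schwarz gives the norm bound. -/
theorem exists_inner_sub_le_zero_and_norm_le {M : Set E} (hM : IsComplete M) (hconv : Convex ℝ M)
    {x : E} (hx : x ∈ M) (u : E) :
    ∃ p ∈ M, (∀ z ∈ M, ⟪u - p, z - p⟫_ℝ ≤ 0) ∧ ‖p - x‖ ≤ ‖u - x‖ := by
  obtain ⟨p, hp, hmin⟩ := exists_norm_eq_iInf_of_complete_convex ⟨x, hx⟩ hM hconv u
  have hle := (norm_eq_iInf_iff_real_inner_le_zero hconv hp).1 hmin
  refine ⟨p, hp, hle, ?_⟩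
  have h1 : ‖p - x‖ * ‖p - x‖ ≤ ‖u - x‖ * ‖p - x‖ := by
    have h2 : ⟪u - p, x - p⟫_ℝ = ⟪p - x, p - x⟫_ℝ - ⟪u - x, p - x⟫_ℝ := by
      rw [← inner_sub_left, ← neg_sub p x, inner_neg_right, ← inner_neg_left]
      congr 1
      abel
    have h3 := real_inner_le_norm (u - x) (p - x)
    have h4 := hle x hx
    rw [h2, real_inner_self_eq_norm_mul_norm] at h4
    linarith
  rcases (norm_nonneg (p - x)).eq_or_lt with h | h
  · rw [← h]; exact norm_nonneg _
  · exact le_of_mul_le_mul_right h1 h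

/-- Every direction `r` splits at a point `x` of a polytope into a direction `q` pointing into
the polytope and a vector `r - q` that is maximized over the polytope both at `x` and at a point
further along `q`. -/
theorem exists_feasible_direction {A : Set E} (hA : A.Finite) {x : E} (hx : x ∈ convexHull ℝ A)
    (r : E) :
    ∃ (q : E) (t : ℝ), 0 < t ∧ x + t • q ∈ convexHull ℝ A ∧
      (∀ z ∈ convexHull ℝ A, ⟪r - q, z⟫_ℝ ≤ ⟪r - q, x⟫_ℝ) ∧
      ⟪r - q, x + t • q⟫_ℝ = ⟪r - q, x⟫_ℝ := by
  obtain ⟨δ, hδ, hball⟩ := Metric.eventually_nhds_iff.1 (eventually_mem_convexHull_imp hA x)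
  have hr : 0 < ‖r‖ + 1 := by positivity
  -- The `+ 1` covers `r = 0` and makes `t * ‖r‖ < δ` strict.
  set t : ℝ := δ / (‖r‖ + 1) with ht
  have ht0 : 0 < t := by positivity
  have htr : t * ‖r‖ < δ := by
    rw [ht, div_mul_eq_mul_div, div_lt_iff₀ hr]
    linarith
  obtain ⟨p, hp, hle, hnorm⟩ := exists_inner_sub_le_zero_and_norm_le
    (hA.isCompact_convexHull (𝕜 := ℝ)).isComplete (convex_convexHull ℝ A) hx (x + t • r)
  have hdist : dist p x < δ := by
    rw [dist_eq_norm]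
    refine hnorm.trans_lt ?_
    rwa [add_sub_cancel_left, norm_smul, Real.norm_of_nonneg ht0.le]
  set q : E := t⁻¹ • (p - x) with hq
  have hpq : x + t • q = p := by
    rw [hq, smul_inv_smul₀ ht0.ne', add_sub_cancel]
  have hg : x + t • r - p = t • (r - q) := by
    rw [smul_sub, ← hpq]
    abel
  have hmax : ∀ z ∈ convexHull ℝ A, ⟪r - q, z⟫_ℝ ≤ ⟪r - q, p⟫_ℝ := by
    intro z hz
    have h := hle z hz
    rw [hg, real_inner_smul_left, inner_sub_right] at h
    nlinarith
  -- `p` lies in the hull of the atoms maximizing `r - q`; being close to `x`, it forces `x` into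
  -- the same hull.
  have hxF := hball hdist _ (sep_subset A _)
    (mem_convexHull_setOf_inner_eq hp fun a ha => hmax a (subset_convexHull ℝ A ha))
  have hxp : ⟪r - q, x⟫_ℝ = ⟪r - q, p⟫_ℝ := inner_eq_of_mem_convexHull (fun a ha => ha.2) hxF
  refine ⟨q, t, ht0, hpq ▸ hp, fun z hz => hxp ▸ hmax z hz, ?_⟩
  rw [hpq, hxp]

theorem IsActiveSet.nonempty {A : Set E} {x : E} {S : Finset E} (hS : IsActiveSet A x S) :
    S.Nonempty := by
  obtain ⟨-, α, -, h1, -⟩ := hS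
  rw [Finset.nonempty_iff_ne_empty]
  rintro rfl
  simp at h1

/-- The pair `s = v` contributes `0`; an unbounded supremum is `0` by convention, so finiteness of
`A` is not needed. -/
theorem pyramidWidth_nonneg {A : Set E} {x r : E} {S : Finset E} (hS : IsActiveSet A x S) :
    0 ≤ pyramidWidth A S r := by
  obtain ⟨v, hv⟩ := hS.nonempty
  exact Real.sSup_nonneg' ⟨0, ⟨v, hS.1 hv, v, hv, by simp⟩, le_rfl⟩

theorem pyramidalDirWidth_nonneg (A : Set E) (r x : E) : 0 ≤ pyramidalDirWidth A r x := by
  refine Real.sInf_nonneg ?_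
  rintro t ⟨S, hS, rfl⟩
  exact pyramidWidth_nonneg hS

theorem pyramidalDirWidth_le {A : Set E} {r x : E} {S : Finset E} (hS : IsActiveSet A x S) :
    pyramidalDirWidth A r x ≤ pyramidWidth A S r := by
  refine csInf_le ⟨0, ?_⟩ ⟨S, hS, rfl⟩
  rintro t ⟨S', hS', rfl⟩
  exact pyramidWidth_nonneg hS'

theorem pyramidalWidth_le {A K : Set E} {x r : E} (hK : IsExposed ℝ (convexHull ℝ A) K)
    (hx : x ∈ K) (hfeas : IsFeasibleDirection K x r) (hr : r ≠ 0) :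
    pyramidalWidth A ≤ pyramidalDirWidth (K ∩ A) r x := by
  refine csInf_le ⟨0, ?_⟩ ⟨K, x, r, hK, hx, hfeas, hr, rfl⟩
  rintro t ⟨K', x', r', -, -, -, -, rfl⟩
  exact pyramidalDirWidth_nonneg _ _ _

theorem isFeasibleDirection_of_add_smul_mem {K : Set E} {x q : E} {t : ℝ} (ht : 0 < t)
    (h : x + t • q ∈ K) : IsFeasibleDirection K x q := by
  have hmem : t • q ∈ PointedCone.hull ℝ ((fun y => y - x) '' K) :=
    PointedCone.subset_hull ⟨x + t • q, h, add_sub_cancel_left _ _⟩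
  have := PointedCone.smul_mem _ (inv_nonneg.2 ht.le) hmem
  rwa [inv_smul_smul₀ ht.ne'] at this

/-- The first-order lower bound for a convex function that is differentiable at a point relative
to its domain. -/
theorem inner_gradient_le_sub [CompleteSpace E] {M : Set E} {f : E → ℝ} (hf : ConvexOn ℝ M f)
    {x y g : E} (hx : x ∈ M) (hy : y ∈ M) (hg : HasGradientWithinAt f g M x) :
    ⟪g, y - x⟫_ℝ ≤ f y - f x := by
  have hmaps : MapsTo (AffineMap.lineMap x y : ℝ → E) (Icc 0 1) M := fun t ht =>
    hf.1.lineMap_mem hx hy ht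
  have hline : HasDerivWithinAt (AffineMap.lineMap x y : ℝ → E) (y - x) (Icc 0 1) 0 :=
    AffineMap.hasDerivWithinAt_lineMap
  have hder : HasDerivWithinAt (f ∘ (AffineMap.lineMap x y : ℝ → E)) ⟪g, y - x⟫_ℝ (Icc 0 1) 0 := by
    have hg' := hg.hasFDerivWithinAt
    have h := HasFDerivWithinAt.comp_hasDerivWithinAt_of_eq (0 : ℝ) hg' hline hmaps (by simp)
    simpa using h
  have hconv : ConvexOn ℝ (Icc (0 : ℝ) 1) (f ∘ (AffineMap.lineMap x y : ℝ → E)) :=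
    (hf.comp_affineMap (AffineMap.lineMap x y)).subset hmaps (convex_Icc 0 1)
  have h := hconv.le_slope_of_hasDerivWithinAt (by simp) (by simp) zero_lt_one hder
  simpa [slope_def_field] using h

/-- The pyramidal width bounds from below the ratio of the decreases along a pairwise Frank-Wolfe
direction and along a unit vector of positive decrease that points into the polytope. -/
theorem pyramidalWidth_le_inner_div {A : Set E} (hA : A.Finite) {x y : E}
    (hx : x ∈ convexHull ℝ A) (hy : y ∈ convexHull ℝ A) {S : Finset E} (hS : IsActiveSet A x S)
    {r d : E} (hd : IsPairwiseFWDirection A S r d) (hpos : 0 < ⟪r, ‖y - x‖⁻¹ • (y - x)⟫_ℝ) :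
    pyramidalWidth A ≤ ⟪r, d⟫_ℝ / ⟪r, ‖y - x‖⁻¹ • (y - x)⟫_ℝ := by
  obtain ⟨q, t, ht, hmem, hmax, heq⟩ := exists_feasible_direction hA hx r
  set e : E := ‖y - x‖⁻¹ • (y - x) with he
  have hyx : y - x ≠ 0 := by
    rintro h
    simp [he, h] at hpos
  have he1 : ‖e‖ = 1 := by
    rw [he, norm_smul, norm_inv, norm_norm, inv_mul_cancel₀ (norm_ne_zero_iff.2 hyx)]
  have hle : ⟪r, e⟫_ℝ ≤ ‖q‖ := by
    have h1 : ⟪r - q, e⟫_ℝ ≤ 0 := by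
      rw [he, real_inner_smul_right, inner_sub_right]
      exact mul_nonpos_of_nonneg_of_nonpos (by positivity) (sub_nonpos.2 (hmax y hy))
    have h2 := real_inner_le_norm q e
    rw [inner_sub_left] at h1
    rw [he1, mul_one] at h2
    linarith
  have hq : 0 < ‖q‖ := hpos.trans_le hle
  set K : Set E := {w ∈ convexHull ℝ A | ∀ z ∈ convexHull ℝ A, ⟪r - q, z⟫_ℝ ≤ ⟪r - q, w⟫_ℝ}
    with hK
  have hexp : IsExposed ℝ (convexHull ℝ A) K := fun _ => ⟨innerSL ℝ (r - q), rfl⟩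
  have hxK : x ∈ K := ⟨hx, hmax⟩
  have hconst : ∀ w ∈ K, ⟪r - q, w⟫_ℝ = ⟪r - q, x⟫_ℝ := fun w hw =>
    le_antisymm (hmax w hw.1) (hw.2 x hx)
  -- `x` maximizes `r - q` and is a combination of `S` with positive weights, so every atom of `S`
  -- is a maximizer too.
  have hSK : ∀ v ∈ S, v ∈ K := by
    obtain ⟨hSA, α, hα, hα1, hαx⟩ := hS
    intro v hv
    have hvx := inner_eq_of_forall_inner_le (z := id) hα hα1 hαx
      (fun w hw => hmax w (subset_convexHull ℝ A (hSA hw))) v hv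
    refine ⟨subset_convexHull ℝ A (hSA hv), fun z hz => ?_⟩
    rw [show ⟪r - q, v⟫_ℝ = ⟪r - q, x⟫_ℝ from hvx]
    exact hmax z hz
  have hSactive : IsActiveSet (K ∩ A) x S :=
    ⟨fun v hv => ⟨hSK v hv, hS.1 hv⟩, hS.2⟩
  obtain ⟨s, hs, v, hv, hsmax, hvmin, rfl⟩ := hd
  have hd0 : 0 ≤ ⟪r, s - v⟫_ℝ := by
    rw [inner_sub_right]
    exact sub_nonneg.2 (hsmax v (hS.1 hv))
  have hwidth : pyramidWidth (K ∩ A) S q ≤ ⟪r, s - v⟫_ℝ / ‖q‖ := by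
    refine Real.sSup_le ?_ (by positivity)
    rintro _ ⟨s', hs', v', hv', rfl⟩
    rw [real_inner_smul_left, inv_mul_eq_div]
    gcongr
    -- `r - q` takes equal values at `s'` and `v'`, so `q` may be replaced by `r`, for which `s` and
    -- `v` are extremal.
    have h1 := hconst s' hs'.1
    have h2 := hconst v' (hSK v' hv')
    have h3 := hsmax s' hs'.2
    have h4 := hvmin v' hv'
    rw [inner_sub_left] at h1 h2
    rw [inner_sub_right, inner_sub_right]
    rw [inner_sub_left] at h1 h2
    linarith
  calc pyramidalWidth A ≤ pyramidalDirWidth (K ∩ A) q x :=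
        pyramidalWidth_le hexp hxK (isFeasibleDirection_of_add_smul_mem ht
          ⟨hmem, fun z hz => heq ▸ hmax z hz⟩) (norm_pos_iff.1 hq)
    _ ≤ pyramidWidth (K ∩ A) S q := pyramidalDirWidth_le hSactive
    _ ≤ ⟪r, s - v⟫_ℝ / ‖q‖ := hwidth
    _ ≤ ⟪r, s - v⟫_ℝ / ⟪r, e⟫_ℝ := by gcongr

end Preliminaries

end PyramidalWidth

theorem theorem3 {n : ℕ} (A : Set (EuclideanSpace ℝ (Fin n))) (hA : A.Finite)
    (f : EuclideanSpace ℝ (Fin n) → ℝ) (hf : ConvexOn ℝ (convexHull ℝ A) f)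
    (x : EuclideanSpace ℝ (Fin n)) (hx : x ∈ convexHull ℝ A)
    (hsub : ¬ IsMinOn f (convexHull ℝ A) x)
    (S : Finset (EuclideanSpace ℝ (Fin n))) (hS : PyramidalWidth.IsActiveSet A x S)
    (xstar : EuclideanSpace ℝ (Fin n)) (hxstar : xstar ∈ convexHull ℝ A)
    (hopt : IsMinOn f (convexHull ℝ A) xstar)
    (grad : EuclideanSpace ℝ (Fin n))
    (hgrad : HasGradientWithinAt f grad (convexHull ℝ A) x)
    (r : EuclideanSpace ℝ (Fin n)) (hr : r = -grad)
    (ehat : EuclideanSpace ℝ (Fin n)) (hehat : ehat = ‖xstar - x‖⁻¹ • (xstar - x))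
    (d : EuclideanSpace ℝ (Fin n)) (hd : PyramidalWidth.IsPairwiseFWDirection A S r d) :
    0 < ⟪r, ehat⟫_ℝ ∧ PyramidalWidth.pyramidalWidth A ≤ ⟪r, d⟫_ℝ / ⟪r, ehat⟫_ℝ := by
  subst hr hehat
  have hlt : f xstar < f x := by
    by_contra! h
    exact hsub fun y hy => h.trans (hopt hy)
  have hgap := PyramidalWidth.inner_gradient_le_sub hf hx hxstar hgrad
  have hne : xstar - x ≠ 0 := by
    rintro h
    rw [sub_eq_zero.1 h] at hlt
    exact lt_irrefl _ hlt
  have hpos : 0 < ⟪-grad, ‖xstar - x‖⁻¹ • (xstar - x)⟫_ℝ := by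
    rw [real_inner_smul_right, inner_neg_left]
    exact mul_pos (inv_pos.2 (norm_pos_iff.2 hne)) (by linarith)
  exact ⟨hpos, PyramidalWidth.pyramidalWidth_le_inner_div hA hx hxstar hS hd hpos⟩
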